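/- Let $\mathcal C$ be a category with finite limits and let $(\mathcal E,\mathcal M)$ be a stable factorization system in $\mathcal C$: an orthogonal factorization system whose class $\mathcal E$ is stable under pullback (neither $\mathcal E\subseteq\mathrm{Epi}(\mathcal C)$ nor $\mathcal M\subseteq\mathrm{Mono}(\mathcal C)$ is assumed). Let $\mathsf{Span}_{\mathcal E}(\mathcal C)$ be the category with the objects of $\mathcal C$, whose morphisms $A\to B$ are the equivalence classes $[f,g]_{\mathcal E}$ of spans $A\xleftarrow{f}D\xrightarrow{g}B$ under the least equivalence relation that relates $(\tilde f x,\tilde g x)$ to $(\tilde f,\tilde g)$ for all $x\in\mathcal E$, composed by pullback. Let $\mathsf{Rel}_{\mathcal M}(\mathcal C)$ be the category with the same objects whose morphisms $A\to B$ are the isomorphism classes of spans $(f,g)$ with $\langle f,g\rangle: D\to A\times B$ in $\mathcal M$, where a composite is obtained from the composite span by taking the $\mathcal M$-part of the $(\mathcal E,\mathcal M)$-factorization of its induced morphism into the product; identities are obtained in the same way from the identity spans. Both carry the involution $(f,g)^\circ=(g,f)$ and the operation $\wedge$ on hom-sets that sends the spans $(f,g),(p,q):A\to B$ to the span $(\pi_1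 d,\pi_2 d)$, where $d$ is the diagonal of the pullback of $\langle f,g\rangle$ and $\langle p,q\rangle$ over $A\times B$. Then: 1. The identity-on-objects assignment $(f,g)\mapsto[f,g]_{\mathcal E}$ is an isomorphism of categories $\mathsf{Rel}_{\mathcal M}(\mathcal C)\cong\mathsf{Span}_{\mathcal E}(\mathcal C)$, compatible with $(-)^\circ$ and $\wedge$. 2. The following are equivalent: (a) $\mathsf{Span}_{\mathcal E}(\mathcal C)$ with $(-)^\circ$ and $\wedge$ is an allegory; (b) $\mathsf{Rel}_{\mathcal M}(\mathcal C)$ with $(-)^\circ$ and $\wedge$ is an allegory; (c) every split epimorphism of $\mathcal C$ lies in $\mathcal E$; (d) every morphism in $\mathcal M$ is a monomorphism of $\mathcal C$. 3. When these conditions hold, the allegories in (a) and (b) are unitary and tabular. Here an allegory is a category with a partial order on each hom-set that is preserved by composition and has binary infima $\wedge$, and with an identity-on-objects contravariant involution $(-)^\circ$ preserving $\wedge$, such that $(s\cdot r)\wedge t\le s\cdot(r\wedge(s^\circ\cdot t))$ for all $r:A\to B$, $s:B\to C$, $t:A\to C$. A morphism $r$ is a map if $1\le r^\circ\cdot r$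 and $r\cdot r^\circ\le 1$. The allegory is tabular if every morphism $r$ can be written as $r=g\cdot f^\circ$ with maps $f,g$ satisfying $(f^\circ\cdot f)\wedge(g^\circ\cdot g)=1$. It is unitary if there is an object $U$ such that $1_U$ is the maximum of the endomorphisms of $U$ and every object $A$ has a morphism $r:A\to U$ with $1_A\le r^\circ\cdot r$. -/

import Mathlib

open CategoryTheory CategoryTheory.Limits

universe v u

namespace SpanAllegory

/-! ### Stable systems and stable factorization systems -/

section Systems

variable {C : Type u} [Category.{v} C]

/-- A stable system: a class of morphisms that contains the isomorphisms, is closed under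
composition and is stable under pullback. -/
structure IsStableSystem (E : MorphismProperty C) : Prop where
  iso_mem : ∀ {X Y : C} (f : X ⟶ Y), IsIso f → E f
  comp_mem : ∀ {X Y Z : C} (f : X ⟶ Y) (g : Y ⟶ Z), E f → E g → E (f ≫ g)
  of_isPullback : ∀ {X Y Z W : C} {f' : W ⟶ Z} {g' : W ⟶ X} {g : Z ⟶ Y} {f : X ⟶ Y},
    IsPullback f' g' g f → E g → E g'

/-- A stable (orthogonal) factorization system `(E, M)`: both classes are closed under composition
with isomorphisms, every morphism factors as a morphism of `E` followed by a morphism of `M`,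
morphisms of `E` are orthogonal to morphisms of `M` (unique diagonals), and `E` is stable under
pullback. Morphisms in `M` need not be monic, and those in `E` need not be epic. -/
structure IsStableFactorizationSystem (E M : MorphismProperty C) : Prop where
  respectsIso_left : E.RespectsIso
  respectsIso_right : M.RespectsIso
  exists_fac : ∀ {X Y : C} (f : X ⟶ Y),
    ∃ (Z : C) (e : X ⟶ Z) (m : Z ⟶ Y), E e ∧ M m ∧ e ≫ m = f
  existsUnique_diag : ∀ {A B X Y : C} (e : A ⟶ B) (m : X ⟶ Y) (p : A ⟶ X) (q : B ⟶ Y),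
    E e → M m → p ≫ m = e ≫ q → ∃! d : B ⟶ X, e ≫ d = p ∧ d ≫ m = q
  of_isPullback : ∀ {X Y Z W : C} {f' : W ⟶ Z} {g' : W ⟶ X} {g : Z ⟶ Y} {f : X ⟶ Y},
    IsPullback f' g' g f → E g → E g'

namespace IsStableFactorizationSystem

variable {E M : MorphismProperty C}

theorem diag_ext (h : IsStableFactorizationSystem E M) {A B X Y : C} {e : A ⟶ B} {m : X ⟶ Y}
    (he : E e) (hm : M m) {d d' : B ⟶ X} (h₁ : e ≫ d = e ≫ d') (h₂ : d ≫ m = d' ≫ m) :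
    d = d' :=
  (h.existsUnique_diag e m (e ≫ d') (d' ≫ m) he hm (by simp)).unique ⟨h₁, h₂⟩ ⟨rfl, rfl⟩

theorem diag_exists (h : IsStableFactorizationSystem E M) {A B X Y : C} {e : A ⟶ B} {m : X ⟶ Y}
    (he : E e) (hm : M m) {p : A ⟶ X} {q : B ⟶ Y} (w : p ≫ m = e ≫ q) :
    ∃ d : B ⟶ X, e ≫ d = p ∧ d ≫ m = q :=
  (h.existsUnique_diag e m p q he hm w).exists

theorem left_of_iso (h : IsStableFactorizationSystem E M) {X Y : C} (f : X ⟶ Y) (hf : IsIso f) :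
    E f := by
  obtain ⟨Z, e, m, he, hm, rfl⟩ := h.exists_fac f
  have := h.respectsIso_left
  have hs : IsIso m := ⟨inv (e ≫ m) ≫ e, h.diag_ext he hm (by
    rw [← Category.assoc, ← Category.assoc, IsIso.hom_inv_id]; simp) (by simp), by simp⟩
  exact (MorphismProperty.cancel_right_of_respectsIso E e m).2 he

theorem right_of_iso (h : IsStableFactorizationSystem E M) {X Y : C} (f : X ⟶ Y) (hf : IsIso f) :
    M f := by
  obtain ⟨Z, e, m, he, hm, rfl⟩ := h.exists_fac f
  have := h.respectsIso_right
  have hs : IsIso e := ⟨m ≫ inv (e ≫ m),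
    by rw [← Category.assoc, IsIso.hom_inv_id], h.diag_ext he hm (by
    rw [Category.assoc, ← Category.assoc e m, ← Category.assoc (e ≫ m), IsIso.hom_inv_id]
    simp) (by simp)⟩
  exact (MorphismProperty.cancel_left_of_respectsIso M e m).2 hm

theorem left_comp (h : IsStableFactorizationSystem E M) {X Y Z : C} (f : X ⟶ Y) (g : Y ⟶ Z)
    (hf : E f) (hg : E g) : E (f ≫ g) := by
  obtain ⟨W, e, m, he, hm, w⟩ := h.exists_fac (f ≫ g)
  have := h.respectsIso_left
  obtain ⟨d, h₁, h₂⟩ := h.diag_exists hf hm w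
  obtain ⟨d', h₃, h₄⟩ := h.diag_exists hg hm (p := d) (q := 𝟙 _) (by simp [h₂])
  have hs : IsIso m := ⟨d', h.diag_ext he hm (by
    rw [← Category.assoc, w, Category.assoc, h₃, h₁, Category.comp_id]) (by simp [h₄]), h₄⟩
  rw [← w]
  exact (MorphismProperty.cancel_right_of_respectsIso E e m).2 he

theorem right_comp (h : IsStableFactorizationSystem E M) {X Y Z : C} (f : X ⟶ Y) (g : Y ⟶ Z)
    (hf : M f) (hg : M g) : M (f ≫ g) := by
  obtain ⟨W, e, m, he, hm, w⟩ := h.exists_fac (f ≫ g)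
  have := h.respectsIso_right
  obtain ⟨d, h₁, h₂⟩ := h.diag_exists he hg w.symm
  obtain ⟨d', h₃, h₄⟩ := h.diag_exists he hf (p := 𝟙 _) (q := d) (by simp [h₁])
  have hs : IsIso e := ⟨d', h₃, h.diag_ext he hm (by rw [← Category.assoc, h₃]; simp) (by
    rw [Category.assoc, w, ← Category.assoc, h₄, h₂, Category.id_comp])⟩
  rw [← w]
  exact (MorphismProperty.cancel_left_of_respectsIso M e m).2 hm

theorem right_of_isPullback (h : IsStableFactorizationSystem E M) {X Y Z W : C} {f' : W ⟶ Z}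
    {g' : W ⟶ X} {g : Z ⟶ Y} {f : X ⟶ Y} (sq : IsPullback f' g' g f) (hg : M g) : M g' := by
  obtain ⟨V, e, m, he, hm, w⟩ := h.exists_fac g'
  have := h.respectsIso_right
  obtain ⟨d, h₁, h₂⟩ := h.diag_exists he hg (p := f') (q := m ≫ f) (by
    rw [← Category.assoc, w, sq.w])
  have hs : IsIso e := ⟨sq.lift d m h₂, sq.hom_ext (by simp [h₁]) (by simp [w]),
    h.diag_ext he hm (by
      rw [← Category.assoc, show e ≫ sq.lift d m h₂ = 𝟙 _ from
        sq.hom_ext (by simp [h₁]) (by simp [w])]; simp) (by simp [w])⟩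
  rw [← w]
  exact (MorphismProperty.cancel_left_of_respectsIso M e m).2 hm

theorem isStableSystem (h : IsStableFactorizationSystem E M) : IsStableSystem E where
  iso_mem := h.left_of_iso
  comp_mem := h.left_comp
  of_isPullback := h.of_isPullback

/-- Uniqueness of factorizations up to isomorphism. -/
theorem fac_unique (h : IsStableFactorizationSystem E M) {X Y Z Z' : C} {e : X ⟶ Z} {m : Z ⟶ Y}
    {e' : X ⟶ Z'} {m' : Z' ⟶ Y} (he : E e) (hm : M m) (he' : E e') (hm' : M m')
    (w : e ≫ m = e' ≫ m') : ∃ i : Z ≅ Z', i.hom ≫ m' = m := by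
  obtain ⟨d, h₁, h₂⟩ := h.diag_exists he hm' w.symm
  obtain ⟨d', h₃, h₄⟩ := h.diag_exists he' hm w
  exact ⟨⟨d, d', h.diag_ext he hm (by rw [← Category.assoc, h₁, h₃, Category.comp_id])
      (by simp [h₂, h₄]),
    h.diag_ext he' hm' (by rw [← Category.assoc, h₃, h₁, Category.comp_id])
      (by simp [h₂, h₄])⟩, h₂⟩

end IsStableFactorizationSystem

end Systems

/-! ### Allegories -/

section Allegories

/-- An allegory structure on a category: partially ordered hom-sets with binary infima, monotone
composition, an identity-on-objects involution preserving binary infima, and Freyd's modular law.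
Here `r ≫ s` is the composite `s · r`. -/
structure Allegory (A : Type u) [Category.{v} A] where
  [homInf : ∀ X Y : A, SemilatticeInf (X ⟶ Y)]
  rev : ∀ {X Y : A}, (X ⟶ Y) → (Y ⟶ X)
  comp_mono : ∀ {X Y Z : A} {r r' : X ⟶ Y} {s s' : Y ⟶ Z}, r ≤ r' → s ≤ s' → r ≫ s ≤ r' ≫ s'
  rev_rev : ∀ {X Y : A} (r : X ⟶ Y), rev (rev r) = r
  rev_id : ∀ X : A, rev (𝟙 X) = 𝟙 X
  rev_comp : ∀ {X Y Z : A} (r : X ⟶ Y) (s : Y ⟶ Z), rev (r ≫ s) = rev s ≫ rev r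
  rev_inf : ∀ {X Y : A} (r s : X ⟶ Y), rev (r ⊓ s) = rev r ⊓ rev s
  modular : ∀ {X Y Z : A} (r : X ⟶ Y) (s : Y ⟶ Z) (t : X ⟶ Z),
    (r ≫ s) ⊓ t ≤ (r ⊓ (t ≫ rev s)) ≫ s

namespace Allegory

variable {A : Type u} [Category.{v} A] (𝔸 : Allegory A)

/-- The order of the hom-sets of an allegory. -/
def le {X Y : A} (r s : X ⟶ Y) : Prop := letI := 𝔸.homInf; r ≤ s

/-- The binary infimum in the hom-sets of an allegory. -/
def inf {X Y : A} (r s : X ⟶ Y) : X ⟶ Y := letI := 𝔸.homInf; r ⊓ s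

/-- `r` is a map if `1 ≤ r° · r` and `r · r° ≤ 1`. -/
def IsMap {X Y : A} (r : X ⟶ Y) : Prop :=
  𝔸.le (𝟙 X) (r ≫ 𝔸.rev r) ∧ 𝔸.le (𝔸.rev r ≫ r) (𝟙 Y)

/-- The pair of maps `(f, g)` tabulates `r` if `r = g · f°` and `(f° · f) ∧ (g° · g) = 1`. -/
def Tabulates {X Y Z : A} (f : Z ⟶ X) (g : Z ⟶ Y) (r : X ⟶ Y) : Prop :=
  𝔸.IsMap f ∧ 𝔸.IsMap g ∧ r = 𝔸.rev f ≫ g ∧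
    𝔸.inf (f ≫ 𝔸.rev f) (g ≫ 𝔸.rev g) = 𝟙 Z

/-- An allegory is tabular if every morphism is tabulated by some pair of maps. -/
def IsTabular : Prop :=
  ∀ (X Y : A) (r : X ⟶ Y), ∃ (Z : A) (f : Z ⟶ X) (g : Z ⟶ Y), 𝔸.Tabulates f g r

/-- `U` is a partial unit if `1_U` is the maximum of `A(U, U)`. -/
def IsPartialUnit (U : A) : Prop := ∀ r : U ⟶ U, 𝔸.le r (𝟙 U)

/-- `U` is a unit if it is a partial unit and every `X` has a morphism `r : X ⟶ U`
with `1_X ≤ r° · r`. -/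
def IsUnit (U : A) : Prop :=
  𝔸.IsPartialUnit U ∧ ∀ X : A, ∃ r : X ⟶ U, 𝔸.le (𝟙 X) (r ≫ 𝔸.rev r)

/-- An allegory is unitary if it has a unit. -/
def IsUnitary : Prop := ∃ U : A, 𝔸.IsUnit U

end Allegory

end Allegories

/-! ### Spans -/

section Spans

attribute [local simp] pullback.lift_fst pullback.lift_snd pullback.lift_fst_assoc
  pullback.lift_snd_assoc prod.lift_fst prod.lift_snd prod.lift_fst_assoc prod.lift_snd_assoc

variable {C : Type u} [Category.{v} C]

/-- Spans `A ⟵ D ⟶ B` in `C` (no condition on the legs). -/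
abbrev Sp (A B : C) := Span (⊤ : MorphismProperty C) (⊤ : MorphismProperty C) A B

namespace Sp

/-- The span `(f, g)`. -/
abbrev of {A B D : C} (f : D ⟶ A) (g : D ⟶ B) : Sp A B := ⟨D, f, g, trivial, trivial⟩

/-- The reversed span `(f, g)° = (g, f)`. -/
abbrev rev {A B : C} (S : Sp A B) : Sp B A := of S.r S.l

/-- For `S = (f, g)`, the morphism `⟨f, g⟩` to the product. -/
noncomputable abbrev pair [HasBinaryProducts C] {A B : C} (S : Sp A B) : S.apex ⟶ A ⨯ B :=
  prod.lift S.l S.r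

/-- The meet `(f, g) ∧ (p, q)` of spans: the direct product of `⟨f, g⟩` and `⟨p, q⟩` in the comma
category over `A ⨯ B`, given by their pullback. -/
noncomputable abbrev meet [HasBinaryProducts C] [HasPullbacks C] {A B : C} (S T : Sp A B) :
    Sp A B :=
  of ((pullback.fst S.pair T.pair ≫ S.pair) ≫ prod.fst)
    ((pullback.fst S.pair T.pair ≫ S.pair) ≫ prod.snd)

/-- The relation `≤_E`: there is a morphism of spans `S ⟶ T` lying in `E`. -/
def LE (E : MorphismProperty C) {A B : C} (S T : Sp A B) : Prop := ∃ x : S ⟶ T, E x.hom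

/-- The relation `∼_E`: the least equivalence relation containing `≤_E`. (As the isomorphisms are
in `E`, isomorphic spans are related.) -/
def setoid (E : MorphismProperty C) (A B : C) : Setoid (Sp A B) :=
  Relation.EqvGen.setoid (LE E)

theorem pair_fst [HasBinaryProducts C] {A B : C} (S : Sp A B) : S.pair ≫ prod.fst = S.l :=
  prod.lift_fst _ _

theorem pair_snd [HasBinaryProducts C] {A B : C} (S : Sp A B) : S.pair ≫ prod.snd = S.r :=
  prod.lift_snd _ _

theorem isIso_hom {A B : C} {S T : Sp A B} (i : S ≅ T) : IsIso i.hom.hom :=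
  ⟨i.inv.hom, by rw [← Span.comp_hom, i.hom_inv_id]; rfl, by
    rw [← Span.comp_hom, i.inv_hom_id]; rfl⟩

theorem le_of_iso {E : MorphismProperty C} (hE : IsStableSystem E) {A B : C} {S T : Sp A B}
    (i : S ≅ T) : LE E S T := ⟨i.hom, hE.iso_mem _ (isIso_hom i)⟩

theorem LE.rev {E : MorphismProperty C} {A B : C} {S T : Sp A B} (h : LE E S T) :
    LE E S.rev T.rev := by
  obtain ⟨x, hx⟩ := h
  exact ⟨⟨x.hom, x.hom_r, x.hom_l⟩, hx⟩

theorem setoid_rev {E : MorphismProperty C} {A B : C} {S S' : Sp A B} (h : setoid E A B S S') :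
    setoid E B A S.rev S'.rev := by
  induction h with
  | rel _ _ h => exact .rel _ _ h.rev
  | refl => exact .refl _
  | symm _ _ _ ih => exact .symm _ _ ih
  | trans _ _ _ _ _ ih ih' => exact .trans _ _ _ ih ih'

theorem hom_pair [HasBinaryProducts C] {A B : C} {S T : Sp A B} (x : S ⟶ T) : x.hom ≫ T.pair = S.pair := by
  ext <;> simp

/-- Reversal of an isomorphism of spans. -/
def revIso {A B : C} {S T : Sp A B} (i : S ≅ T) : S.rev ≅ T.rev where
  hom := ⟨i.hom.hom, i.hom.hom_r, i.hom.hom_l⟩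
  inv := ⟨i.inv.hom, i.inv.hom_r, i.inv.hom_l⟩
  hom_inv_id := Span.hom_ext (show i.hom.hom ≫ i.inv.hom = 𝟙 S.apex from
    congrArg (fun x : S ⟶ S => x.hom) i.hom_inv_id)
  inv_hom_id := Span.hom_ext (show i.inv.hom ≫ i.hom.hom = 𝟙 T.apex from
    congrArg (fun x : T ⟶ T => x.hom) i.inv_hom_id)

section

variable [HasPullbacks C]

theorem lift_mem_left {E : MorphismProperty C} (hE : IsStableSystem E) {X X' Y Z : C}
    {a : X ⟶ Z} {a' : X' ⟶ Z} (b : Y ⟶ Z) (x : X ⟶ X') (hx : E x) (w : x ≫ a' = a)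
    (w' : (pullback.fst a b ≫ x) ≫ a' = pullback.snd a b ≫ b) :
    E (pullback.lift (f := a') (g := b) (pullback.fst a b ≫ x) (pullback.snd a b) w') := by
  subst w
  refine hE.of_isPullback (f' := pullback.fst _ _) (f := pullback.fst a' b)
    (IsPullback.flip ?_) hx
  exact IsPullback.of_right (h₁₂ := pullback.snd a' b) (v₁₃ := b) (h₂₂ := a')
    (by simpa using (IsPullback.of_hasPullback (x ≫ a') b).flip) (by simp)
    (IsPullback.of_hasPullback a' b).flip

theorem lift_mem_right {E : MorphismProperty C} (hE : IsStableSystem E) {X Y Y' Z : C}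
    (a : X ⟶ Z) {b : Y ⟶ Z} {b' : Y' ⟶ Z} (y : Y ⟶ Y') (hy : E y) (w : y ≫ b' = b)
    (w' : pullback.fst a b ≫ a = (pullback.snd a b ≫ y) ≫ b') :
    E (pullback.lift (f := a) (g := b') (pullback.fst a b) (pullback.snd a b ≫ y) w') := by
  subst w
  refine hE.of_isPullback (f' := pullback.snd _ _) (f := pullback.snd a b')
    (IsPullback.flip ?_) hy
  exact IsPullback.of_right (h₁₂ := pullback.fst a b') (v₁₃ := a) (h₂₂ := b')
    (by simpa using (IsPullback.of_hasPullback a (y ≫ b'))) (by simp)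
    (IsPullback.of_hasPullback a b')

theorem LE.comp_left {E : MorphismProperty C} (hE : IsStableSystem E) {A B D : C} {S S' : Sp A B}
    (h : LE E S S') (T : Sp B D) : LE E (S.comp T) (S'.comp T) := by
  obtain ⟨x, hx⟩ := h
  have w : (pullback.fst S.r T.l ≫ x.hom) ≫ S'.r = pullback.snd S.r T.l ≫ T.l := by
    rw [Category.assoc, x.hom_r, pullback.condition]
  refine ⟨⟨pullback.lift (pullback.fst S.r T.l ≫ x.hom) (pullback.snd S.r T.l) w, ?_, ?_⟩,
    lift_mem_left hE T.l x.hom hx x.hom_r w⟩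
  · change pullback.lift (pullback.fst S.r T.l ≫ x.hom) (pullback.snd S.r T.l) w ≫
      pullback.fst S'.r T.l ≫ S'.l = pullback.fst S.r T.l ≫ S.l
    simp
  · change pullback.lift (pullback.fst S.r T.l ≫ x.hom) (pullback.snd S.r T.l) w ≫
      pullback.snd S'.r T.l ≫ T.r = pullback.snd S.r T.l ≫ T.r
    simp

theorem LE.comp_right {E : MorphismProperty C} (hE : IsStableSystem E) {A B D : C} (S : Sp A B)
    {T T' : Sp B D} (h : LE E T T') : LE E (S.comp T) (S.comp T') := by
  obtain ⟨x, hx⟩ := h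
  have w : pullback.fst S.r T.l ≫ S.r = (pullback.snd S.r T.l ≫ x.hom) ≫ T'.l := by
    rw [Category.assoc, x.hom_l, pullback.condition]
  refine ⟨⟨pullback.lift (pullback.fst S.r T.l) (pullback.snd S.r T.l ≫ x.hom) w, ?_, ?_⟩,
    lift_mem_right hE S.r x.hom hx x.hom_l w⟩
  · change pullback.lift (pullback.fst S.r T.l) (pullback.snd S.r T.l ≫ x.hom) w ≫
      pullback.fst S.r T'.l ≫ S.l = pullback.fst S.r T.l ≫ S.l
    simp
  · change pullback.lift (pullback.fst S.r T.l) (pullback.snd S.r T.l ≫ x.hom) w ≫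
      pullback.snd S.r T'.l ≫ T'.r = pullback.snd S.r T.l ≫ T.r
    simp

/-- Unit law up to isomorphism. -/
noncomputable def idCompIso {A B : C} (S : Sp A B) : Span.comp (Span.id A : Sp A A) S ≅ S := by
  have c : pullback.fst (𝟙 A) S.l = pullback.snd (𝟙 A) S.l ≫ S.l := by
    simpa using pullback.condition (f := 𝟙 A) (g := S.l)
  let i : pullback (𝟙 A) S.l ≅ S.apex :=
    ⟨pullback.snd (𝟙 A) S.l, pullback.lift S.l (𝟙 _) (by simp),
      by apply pullback.hom_ext <;> simp [c], by simp⟩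
  exact Span.mkIso i (show pullback.snd (𝟙 A) S.l ≫ S.l = pullback.fst (𝟙 A) S.l ≫ 𝟙 A by simp [c])
    rfl

/-- Unit law up to isomorphism. -/
noncomputable def compIdIso {A B : C} (S : Sp A B) : Span.comp S (Span.id B : Sp B B) ≅ S := by
  have c : pullback.snd S.r (𝟙 B) = pullback.fst S.r (𝟙 B) ≫ S.r := by
    simpa using (pullback.condition (f := S.r) (g := 𝟙 B)).symm
  let i : pullback S.r (𝟙 B) ≅ S.apex :=
    ⟨pullback.fst S.r (𝟙 B), pullback.lift (𝟙 _) S.r (by simp),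
      by apply pullback.hom_ext <;> simp [c], by simp⟩
  exact Span.mkIso i rfl
    (show pullback.fst S.r (𝟙 B) ≫ S.r = pullback.snd S.r (𝟙 B) ≫ 𝟙 B by simp [c])

/-- Associativity up to isomorphism. -/
noncomputable def assocIso {A B D F : C} (S : Sp A B) (T : Sp B D) (U : Sp D F) :
    Span.comp (S.comp T) U ≅ Span.comp S (T.comp U) := by
  let P := pullback (pullback.snd S.r T.l ≫ T.r) U.l
  let Q := pullback S.r (pullback.fst T.r U.l ≫ T.l)
  let p₁ : P ⟶ pullback S.r T.l := pullback.fst (pullback.snd S.r T.l ≫ T.r) U.l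
  let p₂ : P ⟶ U.apex := pullback.snd (pullback.snd S.r T.l ≫ T.r) U.l
  let q₁ : Q ⟶ S.apex := pullback.fst S.r (pullback.fst T.r U.l ≫ T.l)
  let q₂ : Q ⟶ pullback T.r U.l := pullback.snd S.r (pullback.fst T.r U.l ≫ T.l)
  have p : pullback.fst S.r T.l ≫ S.r = pullback.snd S.r T.l ≫ T.l := pullback.condition
  have q : pullback.fst T.r U.l ≫ T.r = pullback.snd T.r U.l ≫ U.l := pullback.condition
  have p' : (p₁ ≫ pullback.snd S.r T.l) ≫ T.r = p₂ ≫ U.l := by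
    rw [Category.assoc]; exact pullback.condition
  have q' : q₁ ≫ S.r = (q₂ ≫ pullback.fst T.r U.l) ≫ T.l := by
    rw [Category.assoc]; exact pullback.condition
  have hP {W : C} {f g : W ⟶ P} (h₁ : f ≫ p₁ = g ≫ p₁) (h₂ : f ≫ p₂ = g ≫ p₂) : f = g :=
    pullback.hom_ext h₁ h₂
  have hQ {W : C} {f g : W ⟶ Q} (h₁ : f ≫ q₁ = g ≫ q₁) (h₂ : f ≫ q₂ = g ≫ q₂) : f = g :=
    pullback.hom_ext h₁ h₂
  let a : P ⟶ Q := pullback.lift (p₁ ≫ pullback.fst S.r T.l)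
    (pullback.lift (p₁ ≫ pullback.snd S.r T.l) p₂ p') (by simp [p])
  let b : Q ⟶ P := pullback.lift (pullback.lift q₁ (q₂ ≫ pullback.fst T.r U.l) q')
    (q₂ ≫ pullback.snd T.r U.l) (by simp [q])
  have a₁ : a ≫ q₁ = p₁ ≫ pullback.fst S.r T.l := pullback.lift_fst _ _ _
  have a₂ : a ≫ q₂ = pullback.lift (p₁ ≫ pullback.snd S.r T.l) p₂ p' := pullback.lift_snd _ _ _
  have b₁ : b ≫ p₁ = pullback.lift q₁ (q₂ ≫ pullback.fst T.r U.l) q' := pullback.lift_fst _ _ _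
  have b₂ : b ≫ p₂ = q₂ ≫ pullback.snd T.r U.l := pullback.lift_snd _ _ _
  let i : P ≅ Q := ⟨a, b,
    hP (by rw [Category.assoc, b₁]; apply pullback.hom_ext <;> simp [a₁, reassoc_of% a₂])
      (by rw [Category.assoc, b₂, reassoc_of% a₂]; simp),
    hQ (by rw [Category.assoc, a₁, reassoc_of% b₁]; simp)
      (by rw [Category.assoc, a₂]; apply pullback.hom_ext <;> simp [b₂, reassoc_of% b₁])⟩
  refine Span.mkIso i ?_ ?_
  · change a ≫ q₁ ≫ S.l = p₁ ≫ pullback.fst S.r T.l ≫ S.l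
    simp [reassoc_of% a₁]
  · change a ≫ q₂ ≫ pullback.snd T.r U.l ≫ U.r = p₂ ≫ U.r
    simp [reassoc_of% a₂]

theorem setoid_comp {E : MorphismProperty C} (hE : IsStableSystem E) {A B D : C} {S S' : Sp A B}
    {T T' : Sp B D} (h : setoid E A B S S') (h' : setoid E B D T T') :
    setoid E A D (S.comp T) (S'.comp T') := by
  refine Setoid.trans' _ (y := S'.comp T) ?_ ?_
  · clear h'
    induction h with
    | rel _ _ h => exact .rel _ _ (h.comp_left hE T)
    | refl => exact .refl _
    | symm _ _ _ ih => exact .symm _ _ ih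
    | trans _ _ _ _ _ ih ih' => exact .trans _ _ _ ih ih'
  · clear h
    induction h' with
    | rel _ _ h => exact .rel _ _ (LE.comp_right hE S' h)
    | refl => exact .refl _
    | symm _ _ _ ih => exact .symm _ _ ih
    | trans _ _ _ _ _ ih ih' => exact .trans _ _ _ ih ih'

variable [HasBinaryProducts C]

theorem LE.meet_left {E : MorphismProperty C} (hE : IsStableSystem E) {A B : C} {S S' : Sp A B}
    (h : LE E S S') (T : Sp A B) : LE E (S.meet T) (S'.meet T) := by
  obtain ⟨x, hx⟩ := h
  have w : (pullback.fst S.pair T.pair ≫ x.hom) ≫ S'.pair = pullback.snd S.pair T.pair ≫ T.pair := by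
    rw [Category.assoc, hom_pair, pullback.condition]
  have e : pullback.lift (pullback.fst S.pair T.pair ≫ x.hom) (pullback.snd S.pair T.pair) w ≫
      pullback.fst S'.pair T.pair ≫ S'.pair = pullback.fst S.pair T.pair ≫ S.pair := by
    simp [-prod.comp_lift, hom_pair]
  refine ⟨⟨pullback.lift (pullback.fst S.pair T.pair ≫ x.hom) (pullback.snd S.pair T.pair) w, ?_, ?_⟩,
    lift_mem_left hE T.pair x.hom hx (hom_pair x) w⟩
  · exact (Category.assoc _ _ _).symm.trans (e =≫ prod.fst)
  · exact (Category.assoc _ _ _).symm.trans (e =≫ prod.snd)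

theorem LE.meet_right {E : MorphismProperty C} (hE : IsStableSystem E) {A B : C} (S : Sp A B)
    {T T' : Sp A B} (h : LE E T T') : LE E (S.meet T) (S.meet T') := by
  obtain ⟨x, hx⟩ := h
  have w : pullback.fst S.pair T.pair ≫ S.pair = (pullback.snd S.pair T.pair ≫ x.hom) ≫ T'.pair := by
    rw [Category.assoc, hom_pair, pullback.condition]
  have e : pullback.lift (pullback.fst S.pair T.pair) (pullback.snd S.pair T.pair ≫ x.hom) w ≫
      pullback.fst S.pair T'.pair ≫ S.pair = pullback.fst S.pair T.pair ≫ S.pair := by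
    simp [-prod.comp_lift]
  refine ⟨⟨pullback.lift (pullback.fst S.pair T.pair) (pullback.snd S.pair T.pair ≫ x.hom) w, ?_, ?_⟩,
    lift_mem_right hE S.pair x.hom hx (hom_pair x) w⟩
  · exact (Category.assoc _ _ _).symm.trans (e =≫ prod.fst)
  · exact (Category.assoc _ _ _).symm.trans (e =≫ prod.snd)

theorem setoid_meet {E : MorphismProperty C} (hE : IsStableSystem E) {A B : C} {S S' : Sp A B}
    {T T' : Sp A B} (h : setoid E A B S S') (h' : setoid E A B T T') :
    setoid E A B (S.meet T) (S'.meet T') := by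
  refine Setoid.trans' _ (y := S'.meet T) ?_ ?_
  · clear h'
    induction h with
    | rel _ _ h => exact .rel _ _ (h.meet_left hE T)
    | refl => exact .refl _
    | symm _ _ _ ih => exact .symm _ _ ih
    | trans _ _ _ _ _ ih ih' => exact .trans _ _ _ ih ih'
  · clear h
    induction h' with
    | rel _ _ h => exact .rel _ _ (LE.meet_right hE S' h)
    | refl => exact .refl _
    | symm _ _ _ ih => exact .symm _ _ ih
    | trans _ _ _ _ _ ih ih' => exact .trans _ _ _ ih ih'

end

end Sp

/-! ### The category `Span_E(C)` -/

/-- The objects of `Span_E(C)`, for a stable system `E`: those of `C`. -/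
structure SpanCat {E : MorphismProperty C} (hE : IsStableSystem E) where
  obj : C

namespace SpanCat

variable {E : MorphismProperty C} {hE : IsStableSystem E}

/-- Morphisms of `Span_E(C)`: the `∼_E`-equivalence classes `[f, g]_E` of spans. -/
def Hom (A B : SpanCat hE) : Type max u v := Quotient (Sp.setoid E A.obj B.obj)

/-- The class `[f, g]_E` of a span `(f, g)`. -/
def Hom.mk {A B : SpanCat hE} (S : Sp A.obj B.obj) : Hom A B :=
  Quotient.mk (Sp.setoid E A.obj B.obj) S

theorem Hom.mk_eq_of_le {A B : SpanCat hE} {S T : Sp A.obj B.obj} (h : Sp.LE E S T) :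
    (Hom.mk S : Hom A B) = Hom.mk T := Quotient.sound (s := Sp.setoid E _ _) (.rel _ _ h)

variable [HasPullbacks C]

/-- Horizontal composition of classes of spans. -/
noncomputable def Hom.comp {A B D : SpanCat hE} (r : Hom A B) (s : Hom B D) : Hom A D :=
  Quotient.map₂ (sa := Sp.setoid E A.obj B.obj) (sb := Sp.setoid E B.obj D.obj)
    (sc := Sp.setoid E A.obj D.obj) (fun S T => S.comp T)
    (fun _ _ h _ _ h' => Sp.setoid_comp hE h h') r s

noncomputable instance : Category.{max u v} (SpanCat hE) where
  Hom := Hom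
  id A := Hom.mk (Span.id A.obj)
  comp := Hom.comp
  id_comp := by
    rintro A B ⟨S⟩
    exact Hom.mk_eq_of_le (Sp.le_of_iso hE (Sp.idCompIso S))
  comp_id := by
    rintro A B ⟨S⟩
    exact Hom.mk_eq_of_le (Sp.le_of_iso hE (Sp.compIdIso S))
  assoc := by
    rintro A B D F ⟨S⟩ ⟨T⟩ ⟨U⟩
    exact Hom.mk_eq_of_le (Sp.le_of_iso hE (Sp.assocIso S T U))

/-- The class `[f, g]_E` as a morphism of `Span_E(C)`. -/
def cls {A B : SpanCat hE} (S : Sp A.obj B.obj) : A ⟶ B := Hom.mk S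

/-- The involution `[f, g]° = [g, f]` of `Span_E(C)`. -/
def rev {A B : SpanCat hE} (r : A ⟶ B) : B ⟶ A :=
  Quotient.map (sa := Sp.setoid E A.obj B.obj) (sb := Sp.setoid E B.obj A.obj) (fun S => S.rev)
    (fun _ _ h => Sp.setoid_rev h) r

/-- The meet `[f, g] ∧ [p, q] = [(f, g) ∧ (p, q)]` of `Span_E(C)`. -/
noncomputable def meet [HasBinaryProducts C] {A B : SpanCat hE} (r s : A ⟶ B) : A ⟶ B :=
  Quotient.map₂ (sa := Sp.setoid E A.obj B.obj) (sb := Sp.setoid E A.obj B.obj)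
    (sc := Sp.setoid E A.obj B.obj) (fun S T => S.meet T)
    (fun _ _ h _ _ h' => Sp.setoid_meet hE h h') r s

/-- The allegory structure `𝔸` on `Span_E(C)` is the one given by the operations
`[f, g]° = [g, f]` and `[f, g] ∧ [p, q] = [(f, g) ∧ (p, q)]`. Its order is then also determined:
`r ≤ s` iff `r ∧ s = r`. -/
def IsCanonical [HasBinaryProducts C] (𝔸 : Allegory (SpanCat hE)) : Prop :=
  (∀ (A B : SpanCat hE) (r : A ⟶ B), 𝔸.rev r = rev r) ∧
    ∀ (A B : SpanCat hE) (r s : A ⟶ B), 𝔸.inf r s = meet r s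

end SpanCat

/-! ### The category `Rel_M(C)` -/

/-- The objects of `Rel_M(C)`, for a stable factorization system `(E, M)`: those of `C`. -/
structure MRelCat {E M : MorphismProperty C} (h : IsStableFactorizationSystem E M) where
  obj : C

section MSpans

variable [HasBinaryProducts C]

/-- Spans `(f, g)` with `⟨f, g⟩` in `M`. -/
abbrev MSp (M : MorphismProperty C) (A B : C) := {S : Sp A B // M S.pair}

/-- Isomorphism of `M`-spans. -/
def MSp.setoid (M : MorphismProperty C) (A B : C) : Setoid (MSp M A B) :=
  (isIsomorphicSetoid (Sp A B)).comap Subtype.val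

variable {E M : MorphismProperty C}

theorem MSp.exists_image (h : IsStableFactorizationSystem E M) {A B : C} (S : Sp A B) :
    ∃ m : Σ Z : C, (Z ⟶ A ⨯ B), M m.2 ∧ ∃ e : S.apex ⟶ m.1, E e ∧ e ≫ m.2 = S.pair := by
  obtain ⟨Z, e, m, he, hm, w⟩ := h.exists_fac S.pair
  exact ⟨⟨Z, m⟩, hm, e, he, w⟩

/-- The `M`-span `(π₁ m, π₂ m)`, where `m` is the `M`-part of a (chosen) `(E, M)`-factorization of
`⟨f, g⟩`. -/
noncomputable def MSp.image (h : IsStableFactorizationSystem E M) {A B : C} (S : Sp A B) :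
    MSp M A B :=
  ⟨Sp.of ((MSp.exists_image h S).choose.2 ≫ prod.fst) ((MSp.exists_image h S).choose.2 ≫ prod.snd),
    by simpa only [Sp.pair, ← prod.comp_lift, prod.lift_fst_snd, Category.comp_id] using
      (MSp.exists_image h S).choose_spec.1⟩

theorem MSp.le_image (h : IsStableFactorizationSystem E M) {A B : C} (S : Sp A B) :
    Sp.LE E S (MSp.image h S).1 := by
  obtain ⟨e, he, w⟩ := (MSp.exists_image h S).choose_spec.2
  exact ⟨⟨e, (reassoc_of% w) prod.fst |>.trans S.pair_fst, (reassoc_of% w) prod.snd |>.trans S.pair_snd⟩, he⟩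

theorem MSp.setoid_val (h : IsStableFactorizationSystem E M) {A B : C} {S T : MSp M A B}
    (hST : MSp.setoid M A B S T) : Sp.setoid E A B S.1 T.1 :=
  .rel _ _ (Sp.le_of_iso h.isStableSystem hST.some)

theorem MSp.iso_of_le (h : IsStableFactorizationSystem E M) {A B : C} {S : Sp A B}
    {T T' : MSp M A B} (hT : Sp.LE E S T.1) (hT' : Sp.LE E S T'.1) : MSp.setoid M A B T T' := by
  obtain ⟨x, hx⟩ := hT
  obtain ⟨y, hy⟩ := hT'
  obtain ⟨i, hi⟩ := h.fac_unique hx T.2 hy T'.2 ((Sp.hom_pair x).trans (Sp.hom_pair y).symm)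
  refine ⟨Span.mkIso i ?_ ?_⟩
  · rw [← Sp.pair_fst, ← Sp.pair_fst, ← hi, Category.assoc]
  · rw [← Sp.pair_snd, ← Sp.pair_snd, ← hi, Category.assoc]

theorem MSp.image_congr (h : IsStableFactorizationSystem E M) {A B : C} {S T : Sp A B}
    (hST : Sp.setoid E A B S T) : MSp.setoid M A B (MSp.image h S) (MSp.image h T) := by
  induction hST with
  | rel S T hST =>
    obtain ⟨x, hx⟩ := hST
    obtain ⟨y, hy⟩ := MSp.le_image h T
    exact MSp.iso_of_le h (MSp.le_image h S) ⟨x ≫ y, h.left_comp _ _ hx hy⟩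
  | refl => exact Setoid.refl' _ _
  | symm _ _ _ ih => exact Setoid.symm' _ ih
  | trans _ _ _ _ _ ih ih' => exact Setoid.trans' _ ih ih'

/-- The reversed `M`-span. -/
def MSp.rev (h : IsStableFactorizationSystem E M) {A B : C} (S : MSp M A B) : MSp M B A :=
  ⟨S.1.rev, by
    have := h.respectsIso_right
    have e : S.1.rev.pair = S.1.pair ≫ (prod.braiding A B).hom := by
      apply prod.hom_ext
      · rw [Sp.pair_fst, prod.braiding_hom, Category.assoc, prod.lift_fst, Sp.pair_snd]
      · rw [Sp.pair_snd, prod.braiding_hom, Category.assoc, prod.lift_snd, Sp.pair_fst]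
    rw [e]
    exact (MorphismProperty.cancel_right_of_respectsIso M _ _).2 S.2⟩

variable [HasPullbacks C]

/-- The meet of two `M`-spans is an `M`-span, as `M` is stable under pullback and composition. -/
noncomputable def MSp.meet (h : IsStableFactorizationSystem E M) {A B : C} (S T : MSp M A B) :
    MSp M A B :=
  ⟨S.1.meet T.1, by
    simpa only [Sp.pair, ← prod.comp_lift, prod.lift_fst_snd, Category.comp_id] using
      h.right_comp _ _ (h.right_of_isPullback
        (IsPullback.of_hasPullback S.1.pair T.1.pair).flip T.2) S.2⟩

end MSpans

namespace MRelCat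

variable [HasBinaryProducts C] {E M : MorphismProperty C} {h : IsStableFactorizationSystem E M}

/-- Morphisms of `Rel_M(C)`: isomorphism classes of spans `(f, g)` with `⟨f, g⟩` in `M`. -/
def Hom (A B : MRelCat h) : Type max u v := Quotient (MSp.setoid M A.obj B.obj)

/-- The isomorphism class of an `M`-span. -/
def Hom.mk {A B : MRelCat h} (S : MSp M A.obj B.obj) : Hom A B :=
  Quotient.mk (MSp.setoid M A.obj B.obj) S

variable [HasPullbacks C]

/-- The class `[f, g]_E` of an `M`-relation `(f, g)`. -/
def Hom.toSpan {A B : MRelCat h} (r : Hom A B) :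
    (⟨A.obj⟩ : SpanCat h.isStableSystem) ⟶ ⟨B.obj⟩ :=
  Quotient.lift (s := MSp.setoid M A.obj B.obj)
    (fun S => SpanCat.cls (hE := h.isStableSystem) (A := ⟨A.obj⟩) (B := ⟨B.obj⟩) S.1)
    (fun _ _ hST => Quotient.sound (s := Sp.setoid E _ _) (MSp.setoid_val h hST)) r

theorem Hom.toSpan_injective {A B : MRelCat h} :
    Function.Injective (Hom.toSpan (A := A) (B := B)) := by
  rintro ⟨S⟩ ⟨T⟩ hST
  have hST' : Sp.setoid E A.obj B.obj S.1 T.1 := Quotient.exact (s := Sp.setoid E _ _) hST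
  have key : ∀ S : MSp M A.obj B.obj, MSp.setoid M A.obj B.obj S (MSp.image h S.1) := fun S =>
    MSp.iso_of_le h ⟨𝟙 S.1, h.left_of_iso _ (inferInstanceAs (IsIso (𝟙 _)))⟩ (MSp.le_image h S.1)
  exact Quotient.sound (s := MSp.setoid M _ _) (Setoid.trans' _ (key S)
    (Setoid.trans' _ (MSp.image_congr h hST') (Setoid.symm' _ (key T))))

/-- The composite of `M`-relations: the `M`-part of the composite of spans. -/
noncomputable def Hom.comp {A B D : MRelCat h} (r : Hom A B) (s : Hom B D) : Hom A D :=
  Quotient.map₂ (sa := MSp.setoid M A.obj B.obj) (sb := MSp.setoid M B.obj D.obj)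
    (sc := MSp.setoid M A.obj D.obj) (fun S T => MSp.image h (S.1.comp T.1))
    (fun _ _ hS _ _ hT => MSp.image_congr h
      (Sp.setoid_comp h.isStableSystem (MSp.setoid_val h hS) (MSp.setoid_val h hT))) r s

/-- The identity `M`-relation: the `M`-part of the identity span. -/
noncomputable def Hom.id (A : MRelCat h) : Hom A A := Hom.mk (MSp.image h (Span.id A.obj))

theorem Hom.toSpan_id (A : MRelCat h) : (Hom.id A).toSpan = 𝟙 _ :=
  (SpanCat.Hom.mk_eq_of_le (MSp.le_image h _)).symm

theorem Hom.toSpan_comp {A B D : MRelCat h} (r : Hom A B) (s : Hom B D) :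
    (r.comp s).toSpan = r.toSpan ≫ s.toSpan := by
  obtain ⟨S⟩ := r
  obtain ⟨T⟩ := s
  exact (SpanCat.Hom.mk_eq_of_le (MSp.le_image h _)).symm

noncomputable instance : Category.{max u v} (MRelCat h) where
  Hom := Hom
  id := Hom.id
  comp := Hom.comp
  id_comp r := Hom.toSpan_injective (by
    rw [Hom.toSpan_comp, Hom.toSpan_id, Category.id_comp])
  comp_id r := Hom.toSpan_injective (by
    rw [Hom.toSpan_comp, Hom.toSpan_id, Category.comp_id])
  assoc r s t := Hom.toSpan_injective (by
    rw [Hom.toSpan_comp, Hom.toSpan_comp, Hom.toSpan_comp, Hom.toSpan_comp, Category.assoc])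

/-- The functor `Rel_M(C) ⥤ Span_E(C)` that is the identity on objects and takes an `M`-relation
`(f, g)` to its class `[f, g]_E`. -/
noncomputable def toSpanCat (h : IsStableFactorizationSystem E M) :
    MRelCat h ⥤ SpanCat h.isStableSystem where
  obj A := ⟨A.obj⟩
  map r := Hom.toSpan r
  map_id := Hom.toSpan_id
  map_comp := Hom.toSpan_comp

/-- The involution `(f, g)° = (g, f)` of `Rel_M(C)`. -/
def rev {A B : MRelCat h} (r : A ⟶ B) : B ⟶ A :=
  Quotient.map (sa := MSp.setoid M A.obj B.obj) (sb := MSp.setoid M B.obj A.obj) (MSp.rev h)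
    (by
      rintro S T ⟨i⟩
      exact ⟨Sp.revIso i⟩) r

/-- The meet `(f, g) ∧ (p, q)` of `Rel_M(C)`. -/
noncomputable def meet {A B : MRelCat h} (r s : A ⟶ B) : A ⟶ B :=
  Quotient.map₂ (sa := MSp.setoid M A.obj B.obj) (sb := MSp.setoid M A.obj B.obj)
    (sc := MSp.setoid M A.obj B.obj) (MSp.meet h)
    (by
      rintro S S' hS T T' hT
      exact Quotient.exact (s := MSp.setoid M _ _) (Hom.toSpan_injective (h := h)
        (A := ⟨A.obj⟩) (B := ⟨B.obj⟩) (Quotient.sound (s := Sp.setoid E _ _)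
          (Sp.setoid_meet h.isStableSystem (MSp.setoid_val h hS) (MSp.setoid_val h hT))))) r s

/-- The allegory structure `𝔸` on `Rel_M(C)` is the one given by the operations `(f, g)° = (g, f)`
and `(f, g) ∧ (p, q)`. -/
def IsCanonical (𝔸 : Allegory (MRelCat h)) : Prop :=
  (∀ (A B : MRelCat h) (r : A ⟶ B), 𝔸.rev r = rev r) ∧
    ∀ (A B : MRelCat h) (r s : A ⟶ B), 𝔸.inf r s = meet r s

end MRelCat

end Spans

end SpanAllegory

open SpanAllegory

namespace SpanAllegory

/-! ### Transport of allegories along fully faithful functors -/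

namespace Allegory

variable {A : Type*} [Category* A]

/-! Every span `S` has an `E`-morphism to its image, the `M`-part of its pairing, and factorizations
are unique up to isomorphism. So each `∼_E`-class contains exactly one `M`-span up to isomorphism,
and taking images inverts `(f, g) ↦ [f, g]_E`. Allegory structures, units and tabulations are
carried across this isomorphism by `comap`, which leaves everything to be shown for `Span_E`.

Suppose split epimorphisms lie in `E`. A span morphism `x : S ⟶ T` makes the projection `S ∧ T ⟶ S`
split epic, with section `⟨1, x⟩`, so `[S] ∧ [T] = [S]` (`meet_cls_eq_left`). Thus `[S] ≤ [T]` as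
soon as a morphism `S ⟶ T` exists, and each allegory axiom only asks for span morphisms, which
pullbacks supply; the modular law is `nonempty_modular`.

Conversely, let `f : X ⟶ Y` have a section `σ`. Then `[1, σ] ≤ [f, 1]` holds for any `E`. Composing
with `X ⟶ 1` in an allegory gives `[1, !] ≤ [f, !]`; as `Y ⨯ 1 ≅ Y`, this says `(f, !) ∼_E (1, !)`.
Having the left leg in `E` is invariant under `∼_E`, so `f` is in `E` (`mem_of_isSplitEpi`).

That split epimorphisms lie in `E` exactly when `M` consists of monomorphisms comes from factoring a
split epimorphism in one direction and from kernel pairs in the other. With `M` monic, the graphs of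
the legs of the image of a span tabulate it; the terminal object is a unit. -/

theorem le_iff_inf_eq (𝔸 : Allegory A) {X Y : A} (r s : X ⟶ Y) : 𝔸.le r s ↔ 𝔸.inf r s = r :=
  letI := 𝔸.homInf
  inf_eq_left.symm

variable {B : Type*} [Category* B] {F : A ⥤ B}

/-- The allegory structure induced along a fully faithful functor. -/
def comap (𝔹 : Allegory B) (hF : F.FullyFaithful) : Allegory A where
  homInf X Y :=
    letI := 𝔹.homInf
    { le := fun r s => F.map r ≤ F.map s
      inf := fun r s => hF.preimage (F.map r ⊓ F.map s)
      le_refl := fun r => le_refl (F.map r)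
      le_trans := fun _ _ _ h₁ h₂ => le_trans (α := F.obj X ⟶ F.obj Y) h₁ h₂
      le_antisymm := fun _ _ h₁ h₂ => hF.map_injective (le_antisymm h₁ h₂)
      inf_le_left := fun r s => by
        rw [hF.map_preimage]
        exact inf_le_left
      inf_le_right := fun r s => by
        rw [hF.map_preimage]
        exact inf_le_right
      le_inf := fun r s t h₁ h₂ => by
        rw [hF.map_preimage]
        exact le_inf h₁ h₂ }
  rev r := hF.preimage (𝔹.rev (F.map r))
  comp_mono {X Y Z r r' s s'} h₁ h₂ := by
    let := 𝔹.homInf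
    change F.map (r ≫ s) ≤ F.map (r' ≫ s')
    rw [F.map_comp, F.map_comp]
    exact 𝔹.comp_mono h₁ h₂
  rev_rev r := hF.map_injective (by simp only [hF.map_preimage, 𝔹.rev_rev])
  rev_id X := hF.map_injective (by simp only [hF.map_preimage, F.map_id, 𝔹.rev_id])
  rev_comp r s := hF.map_injective (by simp only [hF.map_preimage, F.map_comp, 𝔹.rev_comp])
  rev_inf r s := hF.map_injective (by
    let := 𝔹.homInf
    change F.map (hF.preimage (𝔹.rev (F.map (hF.preimage _)))) = F.map (hF.preimage _)
    simp only [hF.map_preimage]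
    exact 𝔹.rev_inf _ _)
  modular r s t := by
    let := 𝔹.homInf
    change F.map (hF.preimage (F.map (r ≫ s) ⊓ F.map t)) ≤
      F.map (hF.preimage (F.map r ⊓ F.map (t ≫ hF.preimage (𝔹.rev (F.map s)))) ≫ s)
    simp only [hF.map_preimage, F.map_comp]
    exact 𝔹.modular _ _ _

variable (𝔹 : Allegory B) (hF : F.FullyFaithful)

theorem map_comap_rev {X Y : A} (r : X ⟶ Y) :
    F.map ((𝔹.comap hF).rev r) = 𝔹.rev (F.map r) := hF.map_preimage _

theorem map_comap_inf {X Y : A} (r s : X ⟶ Y) :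
    F.map ((𝔹.comap hF).inf r s) = 𝔹.inf (F.map r) (F.map s) := hF.map_preimage _

theorem comap_le {X Y : A} (r s : X ⟶ Y) :
    (𝔹.comap hF).le r s ↔ 𝔹.le (F.map r) (F.map s) := Iff.rfl

variable {𝔹 hF}

theorem IsMap.map {X Y : A} {r : X ⟶ Y} (hr : (𝔹.comap hF).IsMap r) : 𝔹.IsMap (F.map r) := by
  have h₁ := hr.1
  have h₂ := hr.2
  rw [comap_le, F.map_comp, F.map_id, map_comap_rev] at h₁ h₂
  exact ⟨h₁, h₂⟩

theorem Tabulates.map {X Y Z : A} {f : Z ⟶ X} {g : Z ⟶ Y} {r : X ⟶ Y}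
    (h : (𝔹.comap hF).Tabulates f g r) : 𝔹.Tabulates (F.map f) (F.map g) (F.map r) := by
  refine ⟨h.1.map, h.2.1.map, ?_, ?_⟩
  · rw [h.2.2.1, F.map_comp, map_comap_rev]
  · have := congrArg F.map h.2.2.2
    simpa only [map_comap_inf, F.map_comp, map_comap_rev, F.map_id] using this

/-- Tabulations are pushed forward by `F`, so only the given morphism and its endpoints need
lifting; fullness and surjectivity on objects do that. -/
theorem IsTabular.of_comap (hs : Function.Surjective F.obj) (h : (𝔹.comap hF).IsTabular) :
    𝔹.IsTabular := by
  intro X Y r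
  obtain ⟨X, rfl⟩ := hs X
  obtain ⟨Y, rfl⟩ := hs Y
  obtain ⟨r, rfl⟩ := hF.map_surjective r
  obtain ⟨Z, f, g, hfg⟩ := h X Y r
  exact ⟨F.obj Z, F.map f, F.map g, hfg.map⟩

theorem IsUnitary.of_comap (hs : Function.Surjective F.obj) (h : (𝔹.comap hF).IsUnitary) :
    𝔹.IsUnitary := by
  obtain ⟨U, h₁, h₂⟩ := h
  refine ⟨F.obj U, fun r => ?_, fun X => ?_⟩
  · obtain ⟨r, rfl⟩ := hF.map_surjective r
    have := h₁ r
    rwa [comap_le, F.map_id] at this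
  · obtain ⟨X, rfl⟩ := hs X
    obtain ⟨r, hr⟩ := h₂ X
    rw [comap_le, F.map_comp, F.map_id, map_comap_rev] at hr
    exact ⟨F.map r, hr⟩

end Allegory

/-! ### Morphisms of spans -/

section Spans

variable {C : Type u} [Category.{v} C]

namespace Sp

variable {A B D : C}

theorem nonempty_rev {S T : Sp A B} (h : Nonempty (S ⟶ T)) : Nonempty (S.rev ⟶ T.rev) :=
  h.map fun x => ⟨x.hom, x.hom_r, x.hom_l⟩

/-- This rests on right cancellation for `E`: if `x` and `x ≫ t` are in `E`, so is `t`. It is the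
invariant that detects membership in `E` from an equality of classes. -/
theorem left_leg_mem_iff_of_setoid {E M : MorphismProperty C} (h : IsStableFactorizationSystem E M)
    {S T : Sp A B} (hST : setoid E A B S T) : E S.l ↔ E T.l := by
  induction hST with
  | rel S T hST =>
    obtain ⟨x, hx⟩ := hST
    rw [← x.hom_l]
    refine ⟨fun hS => ?_, h.left_comp _ _ hx⟩
    obtain ⟨Z, e, m, he, hm, w⟩ := h.exists_fac T.l
    -- Compare the factorizations `(x ≫ e) ≫ m` and `(x ≫ T.l) ≫ 𝟙` of one morphism: `m` must be an
    -- isomorphism.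
    obtain ⟨i, hi⟩ := h.fac_unique (h.left_comp _ _ hx he) hm hS
      (h.right_of_iso (𝟙 _) inferInstance) (by rw [Category.assoc, w, Category.comp_id])
    rw [Category.comp_id] at hi
    rw [← w, ← hi]
    exact h.left_comp _ _ he (h.left_of_iso _ inferInstance)
  | refl => exact Iff.rfl
  | symm _ _ _ ih => exact ih.symm
  | trans _ _ _ _ _ ih ih' => exact ih.trans ih'

section

variable [HasPullbacks C]

/-- The first projection from the apex of a composite span. -/
noncomputable def compFst (S : Sp A B) (T : Sp B D) : (S.comp T).apex ⟶ S.apex :=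
  pullback.fst S.r T.l

/-- The second projection from the apex of a composite span. -/
noncomputable def compSnd (S : Sp A B) (T : Sp B D) : (S.comp T).apex ⟶ T.apex :=
  pullback.snd S.r T.l

theorem comp_condition (S : Sp A B) (T : Sp B D) :
    compFst S T ≫ S.r = compSnd S T ≫ T.l := pullback.condition

theorem compFst_l (S : Sp A B) (T : Sp B D) : compFst S T ≫ S.l = (S.comp T).l := rfl

theorem compSnd_r (S : Sp A B) (T : Sp B D) : compSnd S T ≫ T.r = (S.comp T).r := rfl

theorem nonempty_hom_comp {U : Sp A D} {S : Sp A B} {T : Sp B D} (p : U.apex ⟶ S.apex)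
    (q : U.apex ⟶ T.apex) (w : p ≫ S.r = q ≫ T.l) (hp : p ≫ S.l = U.l) (hq : q ≫ T.r = U.r) :
    Nonempty (U ⟶ S.comp T) :=
  ⟨⟨pullback.lift p q w, (pullback.lift_fst_assoc p q w S.l).trans hp,
    (pullback.lift_snd_assoc p q w T.r).trans hq⟩⟩

theorem nonempty_comp_hom_comp {S S' : Sp A B} {T T' : Sp B D} (h : Nonempty (S ⟶ S'))
    (h' : Nonempty (T ⟶ T')) : Nonempty (S.comp T ⟶ S'.comp T') := by
  obtain ⟨x⟩ := h
  obtain ⟨y⟩ := h'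
  exact nonempty_hom_comp (compFst S T ≫ x.hom) (compSnd S T ≫ y.hom)
    (by simpa using comp_condition S T) (by rw [Category.assoc, x.hom_l, compFst_l])
    (by rw [Category.assoc, y.hom_r, compSnd_r])

theorem nonempty_rev_comp (S : Sp A B) (T : Sp B D) :
    Nonempty (rev (S.comp T) ⟶ T.rev.comp S.rev) :=
  nonempty_hom_comp (compSnd S T) (compFst S T) (comp_condition S T).symm rfl rfl

/-- Reverse the previous morphism for the reversed spans; double reversal is the identity
definitionally. -/
theorem nonempty_comp_rev (S : Sp A B) (T : Sp B D) :
    Nonempty (T.rev.comp S.rev ⟶ rev (S.comp T)) :=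
  nonempty_rev (S := rev (T.rev.comp S.rev)) (T := S.comp T) (nonempty_rev_comp T.rev S.rev)

end

/-! ### Meets of spans and the modular law -/

variable [HasBinaryProducts C] [HasPullbacks C]

/-- The first projection of the meet of spans. -/
noncomputable def meetFst (S T : Sp A B) : S.meet T ⟶ S :=
  ⟨pullback.fst S.pair T.pair,
    by rw [← pair_fst S, ← Category.assoc], by rw [← pair_snd S, ← Category.assoc]⟩

/-- The second projection of the meet of spans. -/
noncomputable def meetSnd (S T : Sp A B) : S.meet T ⟶ T :=
  ⟨pullback.snd S.pair T.pair,
    by rw [← pair_fst T, ← Category.assoc, ← pullback.condition],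
    by rw [← pair_snd T, ← Category.assoc, ← pullback.condition]⟩

/-- The morphism into the meet of spans with given components. -/
noncomputable def meetLift {U S T : Sp A B} (x : U ⟶ S) (y : U ⟶ T) : U ⟶ S.meet T :=
  ⟨pullback.lift x.hom y.hom ((hom_pair x).trans (hom_pair y).symm), by
    change _ ≫ (_ ≫ S.pair) ≫ prod.fst = _
    rw [Category.assoc, pullback.lift_fst_assoc, pair_fst, x.hom_l], by
    change _ ≫ (_ ≫ S.pair) ≫ prod.snd = _
    rw [Category.assoc, pullback.lift_fst_assoc, pair_snd, x.hom_r]⟩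

/-- The section is `⟨1, x⟩`. Through this lemma and its mirror image the hypothesis on split
epimorphisms enters the calculus of classes. -/
theorem isSplitEpi_meetFst {S T : Sp A B} (x : S ⟶ T) : IsSplitEpi (meetFst S T).hom :=
  IsSplitEpi.mk' ⟨(meetLift (𝟙 S) x).hom, pullback.lift_fst _ _ _⟩

theorem isSplitEpi_meetSnd {S T : Sp A B} (x : T ⟶ S) : IsSplitEpi (meetSnd S T).hom :=
  IsSplitEpi.mk' ⟨(meetLift x (𝟙 T)).hom, pullback.lift_snd _ _ _⟩

/-- In generalized elements: a point of the left side consists of composable `s`, `t` and a point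
`u` with the same outer ends; then `s` and `(u, t)` agree in `S ∧ (U · T°)`, and `t` can be composed
on again. -/
theorem nonempty_modular (S : Sp A B) (T : Sp B D) (U : Sp A D) :
    Nonempty (meet (S.comp T) U ⟶ (meet S (U.comp T.rev)).comp T) := by
  let p := meetFst (S.comp T) U
  let q := meetSnd (S.comp T) U
  -- The same apex, but with right end at the middle object `B`, so that the universal property of
  -- the inner meet applies.
  let V : Sp A B := of (meet (S.comp T) U).l (p.hom ≫ compFst S T ≫ S.r)
  have x : V ⟶ S := ⟨p.hom ≫ compFst S T, by
    rw [Category.assoc, compFst_l]; exact p.hom_l, Category.assoc _ _ _⟩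
  obtain ⟨y⟩ : Nonempty (V ⟶ U.comp T.rev) := nonempty_hom_comp q.hom (p.hom ≫ compSnd S T)
    (by
      refine q.hom_r.trans (Eq.trans ?_ (Category.assoc _ _ _).symm)
      exact p.hom_r.symm) q.hom_l (by
      change (p.hom ≫ compSnd S T) ≫ T.l = p.hom ≫ compFst S T ≫ S.r
      rw [Category.assoc, comp_condition])
  exact nonempty_hom_comp (meetLift x y).hom (p.hom ≫ compSnd S T)
    ((meetLift x y).hom_r.trans (by rw [Category.assoc, ← comp_condition]))
    (meetLift x y).hom_l ((Category.assoc _ _ _).trans p.hom_r)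

end Sp

/-! ### The allegory of spans -/

namespace SpanCat

variable {E : MorphismProperty C} {hE : IsStableSystem E} [HasPullbacks C]

theorem exists_cls {A B : SpanCat hE} (r : A ⟶ B) : ∃ S : Sp A.obj B.obj, cls S = r :=
  Quotient.exists_rep r

theorem cls_comp {A B D : SpanCat hE} (S : Sp A.obj B.obj) (T : Sp B.obj D.obj) :
    (cls S : A ⟶ B) ≫ (cls T : B ⟶ D) = cls (S.comp T) := rfl

theorem rev_cls {A B : SpanCat hE} (S : Sp A.obj B.obj) :
    rev (cls S : A ⟶ B) = cls S.rev := rfl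

variable [HasBinaryProducts C]

theorem meet_cls {A B : SpanCat hE} (S T : Sp A.obj B.obj) :
    meet (cls S : A ⟶ B) (cls T) = cls (S.meet T) := rfl

/-! ### Order on classes when split epimorphisms lie in `E` -/

section

variable (hs : ∀ ⦃X Y : C⦄ (f : X ⟶ Y), IsSplitEpi f → E f)
include hs

theorem meet_cls_eq_left {A B : SpanCat hE} {S T : Sp A.obj B.obj} (h : Nonempty (S ⟶ T)) :
    meet (cls S : A ⟶ B) (cls T) = cls S :=
  h.elim fun x => Hom.mk_eq_of_le ⟨_, hs _ (Sp.isSplitEpi_meetFst x)⟩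

/-- Both projections of `S ∧ T` are split epic, so its class equals each of the two. This reduces
identities between classes to morphisms in both directions. -/
theorem cls_eq {A B : SpanCat hE} {S T : Sp A.obj B.obj} (h : Nonempty (S ⟶ T))
    (h' : Nonempty (T ⟶ S)) : (cls S : A ⟶ B) = cls T :=
  (meet_cls_eq_left hs h).symm.trans
    (h'.elim fun x => Hom.mk_eq_of_le ⟨_, hs _ (Sp.isSplitEpi_meetSnd x)⟩)

theorem meet_self {A B : SpanCat hE} (r : A ⟶ B) : meet r r = r := by
  obtain ⟨S, rfl⟩ := exists_cls r
  exact meet_cls_eq_left hs ⟨𝟙 S⟩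

theorem meet_comm {A B : SpanCat hE} (r s : A ⟶ B) : meet r s = meet s r := by
  obtain ⟨S, rfl⟩ := exists_cls r
  obtain ⟨T, rfl⟩ := exists_cls s
  exact cls_eq hs ⟨Sp.meetLift (Sp.meetSnd S T) (Sp.meetFst S T)⟩
    ⟨Sp.meetLift (Sp.meetSnd T S) (Sp.meetFst T S)⟩

theorem meet_assoc {A B : SpanCat hE} (r s t : A ⟶ B) :
    meet (meet r s) t = meet r (meet s t) := by
  obtain ⟨S, rfl⟩ := exists_cls r
  obtain ⟨T, rfl⟩ := exists_cls s
  obtain ⟨U, rfl⟩ := exists_cls t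
  exact cls_eq hs
    ⟨Sp.meetLift (Sp.meetFst (S.meet T) U ≫ Sp.meetFst S T)
      (Sp.meetLift (Sp.meetFst (S.meet T) U ≫ Sp.meetSnd S T) (Sp.meetSnd (S.meet T) U))⟩
    ⟨Sp.meetLift (Sp.meetLift (Sp.meetFst S (T.meet U)) (Sp.meetSnd S (T.meet U) ≫ Sp.meetFst T U))
      (Sp.meetSnd S (T.meet U) ≫ Sp.meetSnd T U)⟩

theorem rev_meet {A B : SpanCat hE} (r s : A ⟶ B) : rev (meet r s) = meet (rev r) (rev s) := by
  obtain ⟨S, rfl⟩ := exists_cls r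
  obtain ⟨T, rfl⟩ := exists_cls s
  have key {X Y : C} (S T : Sp X Y) : Nonempty ((S.meet T).rev ⟶ S.rev.meet T.rev) :=
    (Sp.nonempty_rev ⟨Sp.meetFst S T⟩).elim fun x =>
      (Sp.nonempty_rev ⟨Sp.meetSnd S T⟩).map fun y => Sp.meetLift x y
  exact cls_eq hs (key S T)
    (Sp.nonempty_rev (S := (S.rev.meet T.rev).rev) (T := S.meet T) (key S.rev T.rev))

theorem rev_comp {A B D : SpanCat hE} (r : A ⟶ B) (s : B ⟶ D) :
    rev (r ≫ s) = rev s ≫ rev r := by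
  obtain ⟨S, rfl⟩ := exists_cls r
  obtain ⟨T, rfl⟩ := exists_cls s
  exact cls_eq hs (Sp.nonempty_rev_comp S T) (Sp.nonempty_comp_rev S T)

end

/-- Converse of `meet_cls_eq_left` up to a change of representative: `S ∧ T` also represents `r`,
and it projects to `T`. -/
theorem exists_hom_of_meet_eq_left {A B : SpanCat hE} {r s : A ⟶ B} (h : meet r s = r) :
    ∃ S T : Sp A.obj B.obj, cls S = r ∧ cls T = s ∧ Nonempty (S ⟶ T) := by
  obtain ⟨S, rfl⟩ := exists_cls r
  obtain ⟨T, rfl⟩ := exists_cls s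
  exact ⟨S.meet T, T, h, rfl, ⟨Sp.meetSnd S T⟩⟩

/-- The allegory of `E`-spans, when `E` contains the split epimorphisms. -/
noncomputable def allegory (hs : ∀ ⦃X Y : C⦄ (f : X ⟶ Y), IsSplitEpi f → E f) :
    Allegory (SpanCat hE) where
  homInf A B :=
    { le := fun r s => meet r s = r
      inf := meet
      le_refl := meet_self hs
      le_trans := fun r s t h₁ h₂ => by
        rw [← h₁, meet_assoc hs, h₂]
      le_antisymm := fun r s h₁ h₂ => by rw [← h₁, meet_comm hs, h₂]
      inf_le_left := fun r s => by
        rw [meet_comm hs, ← meet_assoc hs, meet_self hs]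
      inf_le_right := fun r s => by
        rw [meet_assoc hs, meet_self hs]
      le_inf := fun r s t h₁ h₂ => by
        rw [← meet_assoc hs, h₁, h₂] }
  rev := rev
  comp_mono h₁ h₂ := by
    obtain ⟨S, S', rfl, rfl, hS⟩ := exists_hom_of_meet_eq_left h₁
    obtain ⟨T, T', rfl, rfl, hT⟩ := exists_hom_of_meet_eq_left h₂
    exact meet_cls_eq_left hs (Sp.nonempty_comp_hom_comp hS hT)
  rev_rev r := by
    obtain ⟨S, rfl⟩ := exists_cls r
    rfl
  rev_id _ := rfl
  rev_comp := rev_comp hs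
  rev_inf := rev_meet hs
  modular r s t := by
    obtain ⟨S, rfl⟩ := exists_cls r
    obtain ⟨T, rfl⟩ := exists_cls s
    obtain ⟨U, rfl⟩ := exists_cls t
    exact meet_cls_eq_left hs (Sp.nonempty_modular S T U)

theorem isCanonical_allegory (hs : ∀ ⦃X Y : C⦄ (f : X ⟶ Y), IsSplitEpi f → E f) :
    IsCanonical (allegory (hE := hE) hs) :=
  ⟨fun _ _ _ => rfl, fun _ _ _ _ => rfl⟩

/-! ### Units, tabulations, and necessity of the split epimorphism condition -/

theorem IsCanonical.le_iff {𝔸 : Allegory (SpanCat hE)} (h𝔸 : IsCanonical 𝔸) {A B : SpanCat hE}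
    (r s : A ⟶ B) : 𝔸.le r s ↔ meet r s = r := by
  rw [𝔸.le_iff_inf_eq, h𝔸.2]

/-- The unit is the terminal object: any span from it to itself maps to the identity span, and `(1,
!)` is the morphism required from `X`. -/
theorem IsCanonical.isUnitary [HasTerminal C]
    (hs : ∀ ⦃X Y : C⦄ (f : X ⟶ Y), IsSplitEpi f → E f) {𝔸 : Allegory (SpanCat hE)}
    (h𝔸 : IsCanonical 𝔸) : 𝔸.IsUnitary := by
  refine ⟨⟨⊤_ C⟩, fun r => ?_, fun X => ⟨cls (Sp.of (𝟙 _) (terminal.from _)), ?_⟩⟩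
  · rw [h𝔸.le_iff]
    obtain ⟨S, rfl⟩ := exists_cls r
    exact meet_cls_eq_left hs (T := Span.id _)
      ⟨⟨S.l, Category.comp_id _, (Category.comp_id _).trans (terminal.hom_ext _ _)⟩⟩
  · rw [h𝔸.le_iff, h𝔸.1, rev_cls, cls_comp]
    exact meet_cls_eq_left hs (S := Span.id _)
      (Sp.nonempty_hom_comp (𝟙 X.obj) (𝟙 X.obj) rfl (Category.comp_id _) (Category.comp_id _))

/-- The graph of a morphism is a map. -/
theorem IsCanonical.isMap_graph (hs : ∀ ⦃X Y : C⦄ (f : X ⟶ Y), IsSplitEpi f → E f)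
    {𝔸 : Allegory (SpanCat hE)} (h𝔸 : IsCanonical 𝔸) {A B : SpanCat hE} (f : A.obj ⟶ B.obj) :
    𝔸.IsMap (cls (Sp.of (𝟙 _) f) : A ⟶ B) := by
  constructor <;> rw [h𝔸.le_iff, h𝔸.1, rev_cls, cls_comp]
  · exact meet_cls_eq_left hs (S := Span.id _)
      (Sp.nonempty_hom_comp (𝟙 A.obj) (𝟙 A.obj) rfl (Category.comp_id _) (Category.comp_id _))
  · let S : Sp B.obj A.obj := Sp.of f (𝟙 A.obj)
    let T : Sp A.obj B.obj := Sp.of (𝟙 A.obj) f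
    -- The composite is formed over two identities, so its projections and hence its legs coincide,
    -- which gives a morphism to the identity span.
    have w : Sp.compFst S T = Sp.compSnd S T := by simpa [S, T] using Sp.comp_condition S T
    exact meet_cls_eq_left hs (T := Span.id _) ⟨⟨Sp.compFst S T ≫ f, Category.comp_id _, by
      rw [w]; exact Category.comp_id _⟩⟩

/-- The meet of the kernel pairs of the two legs relates only points identified by `S.pair`, hence
only equal points when that is monic. -/
theorem IsCanonical.tabulates (hs : ∀ ⦃X Y : C⦄ (f : X ⟶ Y), IsSplitEpi f → E f)
    {𝔸 : Allegory (SpanCat hE)} (h𝔸 : IsCanonical 𝔸) {A B : SpanCat hE} (S : Sp A.obj B.obj)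
    [Mono S.pair] :
    𝔸.Tabulates (Z := ⟨S.apex⟩) (cls (Sp.of (𝟙 _) S.l)) (cls (Sp.of (𝟙 _) S.r)) (cls S) := by
  refine ⟨h𝔸.isMap_graph hs _, h𝔸.isMap_graph hs _, ?_, ?_⟩
  · rw [h𝔸.1, rev_cls, cls_comp]
    let L : Sp A.obj S.apex := Sp.of S.l (𝟙 _)
    let R : Sp S.apex B.obj := Sp.of (𝟙 _) S.r
    have w : Sp.compFst L R = Sp.compSnd L R := by simpa [L, R] using Sp.comp_condition L R
    refine cls_eq hs (Sp.nonempty_hom_comp (𝟙 S.apex) (𝟙 S.apex) rfl (Category.id_comp _)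
      (Category.id_comp _)) ⟨⟨Sp.compFst L R, rfl, ?_⟩⟩
    rw [w]
    rfl
  · rw [h𝔸.2, h𝔸.1, h𝔸.1, rev_cls, rev_cls, cls_comp, cls_comp, meet_cls]
    -- The kernel pair of `f`, as the graph of `f` followed by its reverse.
    let K {Y : C} (f : S.apex ⟶ Y) : Sp S.apex S.apex :=
      (Sp.of (𝟙 _) f).comp (Sp.of f (𝟙 _))
    have hK {Y : C} (f : S.apex ⟶ Y) : (K f).l ≫ f = (K f).r ≫ f := by
      have := Sp.comp_condition (Sp.of (𝟙 _) f) (Sp.of f (𝟙 _))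
      rw [← Sp.compFst_l, ← Sp.compSnd_r, Category.assoc, Category.assoc]
      simpa using this
    have hid {Y : C} (f : S.apex ⟶ Y) : Nonempty (Span.id S.apex ⟶ K f) :=
      Sp.nonempty_hom_comp (𝟙 _) (𝟙 _) rfl (Category.id_comp _) (Category.id_comp _)
    let N := (K S.l).meet (K S.r)
    have hl : N.l ≫ S.l = N.r ≫ S.l := by
      rw [← (Sp.meetFst (K S.l) (K S.r)).hom_l, ← (Sp.meetFst (K S.l) (K S.r)).hom_r,
        Category.assoc, hK, Category.assoc]
    have hr : N.l ≫ S.r = N.r ≫ S.r := by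
      rw [← (Sp.meetSnd (K S.l) (K S.r)).hom_l, ← (Sp.meetSnd (K S.l) (K S.r)).hom_r,
        Category.assoc, hK, Category.assoc]
    have hN : N.l = N.r := by
      rw [← cancel_mono S.pair]
      apply prod.hom_ext
      · rw [Category.assoc (f := N.l), Category.assoc (f := N.r), Sp.pair_fst, hl]
      · rw [Category.assoc (f := N.l), Category.assoc (f := N.r), Sp.pair_snd, hr]
    exact cls_eq hs (A := ⟨S.apex⟩) (B := ⟨S.apex⟩) (S := N) (T := Span.id S.apex)
      ⟨⟨N.l, Category.comp_id _, (Category.comp_id _).trans hN⟩⟩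
      ⟨Sp.meetLift (hid S.l).some (hid S.r).some⟩

theorem IsCanonical.isTabular {M : MorphismProperty C} {h : IsStableFactorizationSystem E M}
    (hs : ∀ ⦃X Y : C⦄ (f : X ⟶ Y), IsSplitEpi f → E f)
    (hm : ∀ ⦃X Y : C⦄ (f : X ⟶ Y), M f → Mono f)
    {𝔸 : Allegory (SpanCat h.isStableSystem)} (h𝔸 : IsCanonical 𝔸) : 𝔸.IsTabular := by
  intro A B r
  obtain ⟨S, rfl⟩ := exists_cls r
  rw [show cls S = (cls (MSp.image h S).1 : A ⟶ B) from Hom.mk_eq_of_le (MSp.le_image h S)]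
  have := hm _ (MSp.image h S).2
  exact ⟨_, _, _, h𝔸.tabulates hs _⟩

/-- Monotonicity of composition is what forces the condition: an inequality valid for any `E` is
composed with the span to the terminal object, and the result says that `f` is in `E`. -/
theorem IsCanonical.mem_of_isSplitEpi [HasTerminal C] {M : MorphismProperty C}
    {h : IsStableFactorizationSystem E M}
    {𝔸 : Allegory (SpanCat h.isStableSystem)} (h𝔸 : IsCanonical 𝔸) ⦃X Y : C⦄ (f : X ⟶ Y)
    (hf : IsSplitEpi f) : E f := by
  let X' : SpanCat h.isStableSystem := ⟨X⟩
  let Y' : SpanCat h.isStableSystem := ⟨Y⟩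
  let I : SpanCat h.isStableSystem := ⟨⊤_ C⟩
  let σ : Y ⟶ X := section_ f
  have hσ : σ ≫ f = 𝟙 Y := IsSplitEpi.id f
  let G : Sp Y X := Sp.of (𝟙 Y) σ
  let F : Sp Y X := Sp.of f (𝟙 X)
  let t : Sp X (⊤_ C) := Sp.of (𝟙 X) (terminal.from X)
  have hGF : 𝔸.le (cls G : Y' ⟶ X') (cls F) := by
    rw [h𝔸.le_iff]
    let x : G ⟶ F := ⟨σ, hσ, Category.comp_id _⟩
    let i : (G.meet F) ⟶ G := Sp.meetFst G F
    let j : G ⟶ G.meet F := Sp.meetLift (𝟙 G) x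
    -- A leg of `F` is an identity, so its pairing is monic; the split epic projection `G ∧ F ⟶ G`
    -- is then also monic, hence invertible and in `E` without any assumption.
    have hm : Mono F.pair := ⟨fun a b hab => by
      have := congrArg (· ≫ prod.snd) hab
      rwa [Category.assoc, Category.assoc, Sp.pair_snd, Category.comp_id, Category.comp_id] at this⟩
    have hi : Mono i.hom := inferInstanceAs (Mono (pullback.fst G.pair F.pair))
    have hi' : IsSplitEpi i.hom := Sp.isSplitEpi_meetFst x
    exact Hom.mk_eq_of_le ⟨i, h.left_of_iso _ (isIso_of_mono_of_isSplitEpi _)⟩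
  have hle : 𝔸.le ((cls G : Y' ⟶ X') ≫ (cls t : X' ⟶ I)) ((cls F : Y' ⟶ X') ≫ (cls t : X' ⟶ I)) :=
    letI := 𝔸.homInf
    𝔸.comp_mono hGF le_rfl
  rw [h𝔸.le_iff] at hle
  let U : Sp Y (⊤_ C) := G.comp t
  let V : Sp Y (⊤_ C) := F.comp t
  have hU : IsIso (Sp.compFst G t) := inferInstanceAs (IsIso (pullback.fst σ (𝟙 X)))
  have hV : IsIso (Sp.compFst F t) := inferInstanceAs (IsIso (pullback.fst (𝟙 X) (𝟙 X)))
  have hUl : IsIso U.l := inferInstanceAs (IsIso (Sp.compFst G t ≫ 𝟙 Y))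
  -- `U` is the top span up to isomorphism, so `U ∧ V ≅ V` and the inequality turns into an equality
  -- of the classes of `V` and `U`.
  have hUp : IsIso U.pair := by
    have : IsIso (U.pair ≫ prod.fst) := by rwa [Sp.pair_fst]
    have : IsIso (prod.fst : Y ⨯ ⊤_ C ⟶ Y) :=
      inferInstanceAs (IsIso (Limits.prod.rightUnitor Y).hom)
    exact IsIso.of_isIso_comp_right _ (prod.fst (X := Y) (Y := ⊤_ C))
  have hsnd : IsIso (Sp.meetSnd U V).hom := inferInstanceAs (IsIso (pullback.snd U.pair V.pair))
  have hE : E (U.meet V).l := (Sp.left_leg_mem_iff_of_setoid h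
    (Quotient.exact (s := Sp.setoid E Y (⊤_ C)) hle)).2 (h.left_of_iso _ hUl)
  have := h.respectsIso_left
  rw [← (Sp.meetSnd U V).hom_l, MorphismProperty.cancel_left_of_respectsIso E] at hE
  exact (MorphismProperty.cancel_left_of_respectsIso E (Sp.compFst F t) f).1 hE

end SpanCat

/-! ### The isomorphism between the two categories -/

section MSpans

variable [HasBinaryProducts C] [HasPullbacks C] {E M : MorphismProperty C}

namespace SpanCat

variable {h : IsStableFactorizationSystem E M}

/-- The `M`-relation given by the `M`-part of an `E`-span. -/
noncomputable def Hom.toMRel {A B : SpanCat h.isStableSystem} (r : A ⟶ B) :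
    (⟨A.obj⟩ : MRelCat h) ⟶ ⟨B.obj⟩ :=
  Quotient.map (sa := Sp.setoid E A.obj B.obj) (sb := MSp.setoid M A.obj B.obj) (MSp.image h)
    (fun _ _ hST => MSp.image_congr h hST) r

theorem Hom.toSpan_toMRel {A B : SpanCat h.isStableSystem} (r : A ⟶ B) :
    MRelCat.Hom.toSpan (Hom.toMRel (h := h) r) = r := by
  obtain ⟨S, rfl⟩ := exists_cls r
  exact (Hom.mk_eq_of_le (MSp.le_image h S)).symm

/-- Injectivity of `toSpan` makes its right inverse two-sided. -/
theorem Hom.toMRel_toSpan {A B : MRelCat h} (r : A ⟶ B) :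
    Hom.toMRel (MRelCat.Hom.toSpan r) = r :=
  MRelCat.Hom.toSpan_injective (Hom.toSpan_toMRel _)

/-- The inverse of `MRelCat.toSpanCat`. -/
noncomputable def toMRelCat (h : IsStableFactorizationSystem E M) :
    SpanCat h.isStableSystem ⥤ MRelCat h where
  obj A := ⟨A.obj⟩
  map r := Hom.toMRel r
  map_id A := MRelCat.Hom.toSpan_injective
    ((Hom.toSpan_toMRel _).trans (MRelCat.Hom.toSpan_id ⟨A.obj⟩).symm)
  map_comp r s := MRelCat.Hom.toSpan_injective (by
    refine (Hom.toSpan_toMRel _).trans (Eq.trans ?_ (MRelCat.Hom.toSpan_comp _ _).symm)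
    rw [Hom.toSpan_toMRel, Hom.toSpan_toMRel])

/-- `toMRelCat` is fully faithful. -/
noncomputable def fullyFaithfulToMRelCat : (toMRelCat h).FullyFaithful where
  preimage r := MRelCat.Hom.toSpan r
  map_preimage := Hom.toMRel_toSpan
  preimage_map := Hom.toSpan_toMRel

theorem toMRelCat_obj_surjective : Function.Surjective (toMRelCat h).obj := fun A => ⟨⟨A.obj⟩, rfl⟩

end SpanCat

namespace MRelCat

variable {h : IsStableFactorizationSystem E M}

/-- `toSpanCat` is fully faithful. -/
noncomputable def fullyFaithfulToSpanCat : (toSpanCat h).FullyFaithful where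
  preimage r := SpanCat.Hom.toMRel r
  map_preimage := SpanCat.Hom.toSpan_toMRel
  preimage_map := SpanCat.Hom.toMRel_toSpan

theorem toSpanCat_map_rev {A B : MRelCat h} (r : A ⟶ B) :
    (toSpanCat h).map (rev r) = SpanCat.rev ((toSpanCat h).map r) := by
  obtain ⟨S⟩ := r
  rfl

theorem toSpanCat_map_meet {A B : MRelCat h} (r s : A ⟶ B) :
    (toSpanCat h).map (meet r s) =
      SpanCat.meet ((toSpanCat h).map r) ((toSpanCat h).map s) := by
  obtain ⟨S⟩ := r
  obtain ⟨T⟩ := s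
  rfl

theorem toSpanCat_comp_toMRelCat : toSpanCat h ⋙ SpanCat.toMRelCat h = 𝟭 _ :=
  -- Objects agree definitionally, so the heterogeneous equality is an ordinary one.
  CategoryTheory.Functor.hext (fun _ => rfl) fun _ _ r =>
    heq_of_eq (SpanCat.Hom.toMRel_toSpan r)

theorem toMRelCat_comp_toSpanCat : SpanCat.toMRelCat h ⋙ toSpanCat h = 𝟭 _ :=
  CategoryTheory.Functor.hext (fun _ => rfl) fun _ _ r =>
    heq_of_eq (SpanCat.Hom.toSpan_toMRel r)

theorem isCanonical_comap {𝔸 : Allegory (SpanCat h.isStableSystem)} (h𝔸 : SpanCat.IsCanonical 𝔸) :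
    IsCanonical (𝔸.comap (fullyFaithfulToSpanCat (h := h))) := by
  constructor
  · intro A B r
    apply (fullyFaithfulToSpanCat (h := h)).map_injective
    rw [Allegory.map_comap_rev, h𝔸.1, toSpanCat_map_rev]
  · intro A B r s
    apply (fullyFaithfulToSpanCat (h := h)).map_injective
    rw [Allegory.map_comap_inf, h𝔸.2, toSpanCat_map_meet]

end MRelCat

/-! ### Transfer from `Rel_M` back to `Span_E` -/

namespace SpanCat

variable {h : IsStableFactorizationSystem E M}

/-- Checked after applying the faithful inverse `toSpanCat`, which is known to respect reversal. -/
theorem toMRelCat_map_rev {A B : SpanCat h.isStableSystem} (r : A ⟶ B) :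
    (toMRelCat h).map (rev r) = MRelCat.rev ((toMRelCat h).map r) := by
  apply MRelCat.fullyFaithfulToSpanCat.map_injective
  rw [MRelCat.toSpanCat_map_rev]
  change MRelCat.Hom.toSpan (Hom.toMRel _) = rev (MRelCat.Hom.toSpan (Hom.toMRel _))
  rw [Hom.toSpan_toMRel, Hom.toSpan_toMRel]

theorem toMRelCat_map_meet {A B : SpanCat h.isStableSystem} (r s : A ⟶ B) :
    (toMRelCat h).map (meet r s) =
      MRelCat.meet ((toMRelCat h).map r) ((toMRelCat h).map s) := by
  apply MRelCat.fullyFaithfulToSpanCat.map_injective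
  rw [MRelCat.toSpanCat_map_meet]
  change MRelCat.Hom.toSpan (Hom.toMRel _) =
    meet (MRelCat.Hom.toSpan (Hom.toMRel _)) (MRelCat.Hom.toSpan (Hom.toMRel _))
  rw [Hom.toSpan_toMRel, Hom.toSpan_toMRel, Hom.toSpan_toMRel]

theorem isCanonical_comap {𝔸 : Allegory (MRelCat h)} (h𝔸 : MRelCat.IsCanonical 𝔸) :
    IsCanonical (𝔸.comap (fullyFaithfulToMRelCat (h := h))) := by
  constructor
  · intro A B r
    apply (fullyFaithfulToMRelCat (h := h)).map_injective
    rw [Allegory.map_comap_rev, h𝔸.1, toMRelCat_map_rev]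
  · intro A B r s
    apply (fullyFaithfulToMRelCat (h := h)).map_injective
    rw [Allegory.map_comap_inf, h𝔸.2, toMRelCat_map_meet]

end SpanCat

end MSpans

/-! ### Split epimorphisms in `E` versus monomorphisms in `M` -/

namespace IsStableFactorizationSystem

variable {E M : MorphismProperty C} (h : IsStableFactorizationSystem E M)
include h

/-- The `M`-part of a split epimorphism is split epic and, being monic, invertible. -/
theorem mem_left_of_isSplitEpi (hm : ∀ ⦃X Y : C⦄ (f : X ⟶ Y), M f → Mono f)
    ⦃X Y : C⦄ (f : X ⟶ Y) (hf : IsSplitEpi f) : E f := by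
  obtain ⟨Z, e, m, he, hM, w⟩ := h.exists_fac f
  have := hm m hM
  have : IsSplitEpi m := IsSplitEpi.mk' ⟨section_ f ≫ e, by rw [Category.assoc, w, IsSplitEpi.id]⟩
  rw [← w]
  exact h.left_comp _ _ he (h.left_of_iso _ (isIso_of_mono_of_isSplitEpi m))

/-- A kernel pair projection of `m` is split by the diagonal, so in `E`, and is a pullback of `m`,
so in `M`. Being in both classes makes it monic, which trivializes the kernel pair. -/
theorem mono_of_mem_right [HasPullbacks C]
    (hs : ∀ ⦃X Y : C⦄ (f : X ⟶ Y), IsSplitEpi f → E f) ⦃X Y : C⦄ (m : X ⟶ Y) (hm : M m) :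
    Mono m := by
  have he : E (pullback.fst m m) :=
    hs _ (IsSplitEpi.mk' ⟨pullback.lift (𝟙 X) (𝟙 X) rfl, pullback.lift_fst _ _ _⟩)
  have hm' : M (pullback.fst m m) :=
    h.right_of_isPullback (IsPullback.of_hasPullback m m).flip hm
  -- Orthogonality of the projection to itself gives a retraction.
  obtain ⟨d, hd, -⟩ := h.diag_exists he hm' (p := 𝟙 _) (q := 𝟙 X) (by simp)
  have : Mono (pullback.fst m m) := (SplitMono.mk d hd).mono
  refine ⟨fun a b w => ?_⟩
  have key : pullback.lift a b w = pullback.lift a a rfl := by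
    rw [← cancel_mono (pullback.fst m m), pullback.lift_fst, pullback.lift_fst]
  have := congrArg (· ≫ pullback.snd m m) key
  simpa only [pullback.lift_snd] using this.symm

end IsStableFactorizationSystem

end Spans

end SpanAllegory

theorem mainTheorem6 {C : Type u} [Category.{v} C] [HasFiniteLimits C]
    (E M : MorphismProperty C) (h : IsStableFactorizationSystem E M) :
    -- the identity-on-objects functor `(f, g) ↦ [f, g]_E` is an isomorphism of categories
    -- `Rel_M(C) ≅ Span_E(C)`, and it respects the involutions and the meets
    ((∃ R : SpanCat h.isStableSystem ⥤ MRelCat h,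
        MRelCat.toSpanCat h ⋙ R = 𝟭 _ ∧ R ⋙ MRelCat.toSpanCat h = 𝟭 _) ∧
      (∀ (A B : MRelCat h) (r : A ⟶ B),
        (MRelCat.toSpanCat h).map (MRelCat.rev r) =
          SpanCat.rev ((MRelCat.toSpanCat h).map r)) ∧
      (∀ (A B : MRelCat h) (r s : A ⟶ B),
        (MRelCat.toSpanCat h).map (MRelCat.meet r s) =
          SpanCat.meet ((MRelCat.toSpanCat h).map r) ((MRelCat.toSpanCat h).map s))) ∧
    -- the equivalent conditions
    List.TFAE [
      ∃ 𝔸 : Allegory (SpanCat h.isStableSystem), SpanCat.IsCanonical 𝔸,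
      ∃ 𝔸 : Allegory (MRelCat h), MRelCat.IsCanonical 𝔸,
      ∀ ⦃X Y : C⦄ (f : X ⟶ Y), IsSplitEpi f → E f,
      ∀ ⦃X Y : C⦄ (f : X ⟶ Y), M f → Mono f] ∧
    -- the allegories are then unitary and tabular
    (∀ 𝔸 : Allegory (SpanCat h.isStableSystem),
      SpanCat.IsCanonical 𝔸 → 𝔸.IsUnitary ∧ 𝔸.IsTabular) ∧
    (∀ 𝔸 : Allegory (MRelCat h),
      MRelCat.IsCanonical 𝔸 → 𝔸.IsUnitary ∧ 𝔸.IsTabular) := by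
  have hs_of {𝔸 : Allegory (SpanCat h.isStableSystem)} (h𝔸 : SpanCat.IsCanonical 𝔸) :=
    h𝔸.mem_of_isSplitEpi (h := h)
  have htab {𝔸 : Allegory (SpanCat h.isStableSystem)} (h𝔸 : SpanCat.IsCanonical 𝔸) :
      𝔸.IsUnitary ∧ 𝔸.IsTabular :=
    ⟨h𝔸.isUnitary (hs_of h𝔸), h𝔸.isTabular (h := h) (hs_of h𝔸) (h.mono_of_mem_right (hs_of h𝔸))⟩
  refine ⟨⟨⟨SpanCat.toMRelCat h, MRelCat.toSpanCat_comp_toMRelCat,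
    MRelCat.toMRelCat_comp_toSpanCat⟩, fun _ _ => MRelCat.toSpanCat_map_rev,
    fun _ _ => MRelCat.toSpanCat_map_meet⟩, ?_, fun _ => htab, fun _ h𝔸 => ?_⟩
  · tfae_have 1 → 2 := fun ⟨_, h𝔸⟩ => ⟨_, MRelCat.isCanonical_comap h𝔸⟩
    tfae_have 2 → 1 := fun ⟨_, h𝔸⟩ => ⟨_, SpanCat.isCanonical_comap h𝔸⟩
    tfae_have 1 → 3 := fun ⟨_, h𝔸⟩ => hs_of h𝔸
    tfae_have 3 → 1 := fun hs => ⟨_, SpanCat.isCanonical_allegory hs⟩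
    tfae_have 3 → 4 := h.mono_of_mem_right
    tfae_have 4 → 3 := h.mem_left_of_isSplitEpi
    tfae_finish
  -- Pull the structure on `Rel_M` back to `Span_E`, where the claim is known, then push the unit
  -- and the tabulations forward.
  · have := htab (SpanCat.isCanonical_comap h𝔸)
    exact ⟨.of_comap SpanCat.toMRelCat_obj_surjective this.1,
      .of_comap SpanCat.toMRelCat_obj_surjective this.2⟩
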